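/- Let $\mathbb{D}=\{z\in\mathbb{C}:|z|<1\}$ and let $\mathcal{A}$ be the class of functions $f$ analytic in $\mathbb{D}$ of the form $f(z)=z+a_2z^2+a_3z^3+\cdots$. Let $$\mathcal{F}_3=\{f\in\mathcal{A}:\operatorname{Re}\big((1-z+z^2)f'(z)\big)>0\ \text{for all } z\in\mathbb{D}\}.$$ Every $f\in\mathcal{F}_3$ is univalent (injective) in $\mathbb{D}$, and its inverse $f^{-1}:f(\mathbb{D})\to\mathbb{D}$ is analytic near $0$; write $f^{-1}(w)=w+\delta_2w^2+\delta_3w^3+\cdots$ for its expansion there. (a) For every $f\in\mathcal{F}_3$, $$|\delta_2|\le\frac32,\qquad |\delta_3|\le\frac{19}{6}.$$ If, in addition, $a_2\in\mathbb{R}$, then $$|\delta_4|\le\frac{61}{8},\qquad |\delta_5|\le\frac{2371}{120}.$$ (b) All four bounds are sharp: there is a function $f\in\mathcal{F}_3$, with $zf'(z)=\dfrac{z}{1-z+z^2}\cdot\dfrac{1+z}{1-z}$ for $z\in\mathbb{D}$ and with $a_2\in\mathbb{R}$, for which all four inequalities hold with equality. -/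

import Mathlib

namespace InverseCoeffs

/-- The `n`-th Taylor coefficient of `f` at the origin. -/
noncomputable def taylorCoeff (f : ℂ → ℂ) (n : ℕ) : ℂ :=
  iteratedDeriv n f 0 / (n.factorial : ℂ)

/-- The class `𝒜`: functions analytic in the open unit disk with `f 0 = 0` and `f' 0 = 1`,
i.e. `f z = z + a₂ z² + a₃ z³ + ⋯` there. -/
def classA : Set (ℂ → ℂ) :=
  {f | DifferentiableOn ℂ f (Metric.ball 0 1) ∧ f 0 = 0 ∧ deriv f 0 = 1}

/-- The class `ℱ₃`: those `f ∈ 𝒜` with `Re ((1 - z + z²) f' z) > 0` in the open unit disk. -/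
def classF3 : Set (ℂ → ℂ) :=
  {f | f ∈ classA ∧
    ∀ z ∈ Metric.ball (0 : ℂ) 1, 0 < ((1 - z + z ^ 2) * deriv f z).re}

/-- The inverse `f⁻¹` of `f` regarded as a function on the open unit disk: for `w` in the image of
the disk, a point of the disk that `f` maps to `w` (the only one, if `f` is univalent). -/
noncomputable def diskInverse (f : ℂ → ℂ) : ℂ → ℂ :=
  Function.invFunOn f (Metric.ball 0 1)

/-- The `n`-th inverse coefficient `δₙ` of `f`: `f⁻¹ w = w + δ₂ w² + δ₃ w³ + ⋯` near `0`. -/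
noncomputable def inverseCoeff (f : ℂ → ℂ) (n : ℕ) : ℂ :=
  taylorCoeff (diskInverse f) n

end InverseCoeffs

namespace InverseCoeffs
open Filter Topology Metric Complex

/-! Put `q = (1 - z + z²) f'`. Since `Re q > 0` and `q 0 = 1`, the Cayley transform and Schwarz's
lemma give `q = (1 + zφ) / (1 - zφ)` with `|φ| ≤ 1` on the disk. Hence `δ₂, …, δ₅` are polynomials
in the first coefficients `t, u, v, w` of `φ`. Wiener's inequality
(`norm_taylorCoeff_le_one_sub_sq`) bounds `|u|, |v|, |w|` by `1 - |t|²`. The triangle inequality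
then leaves a polynomial in `|t| ∈ [0, 1]` that is largest at `|t| = 1`. This works for complex `t`,
so the bounds on `δ₄` and `δ₅` need no reality of `a₂`. Equality holds for `φ = 1`.

Univalence (`injOn_of_mem_classF3`) is the Noshiro-Warschawski criterion applied to `f ∘ Z`, where
`Z` maps a strip conformally onto the disk and `Z'` is a constant multiple of `1 - Z + Z²`. -/

/-! ### Calculus of Taylor coefficients at the origin. -/

theorem taylorCoeff_congr {f g : ℂ → ℂ} (h : f =ᶠ[𝓝 0] g) (n : ℕ) :
    taylorCoeff f n = taylorCoeff g n := by
  simp only [taylorCoeff, h.iteratedDeriv_eq n]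

theorem taylorCoeff_zero (f : ℂ → ℂ) : taylorCoeff f 0 = f 0 := by
  simp [taylorCoeff]

theorem taylorCoeff_one (f : ℂ → ℂ) : taylorCoeff f 1 = deriv f 0 := by
  simp [taylorCoeff]

theorem taylorCoeff_deriv (f : ℂ → ℂ) (n : ℕ) :
    taylorCoeff (deriv f) n = (n + 1) * taylorCoeff f (n + 1) := by
  have h : (n.factorial : ℂ) ≠ 0 := by exact_mod_cast n.factorial_ne_zero
  have h' : (n + 1 : ℂ) ≠ 0 := by exact_mod_cast n.succ_ne_zero
  simp only [taylorCoeff, ← iteratedDeriv_succ', Nat.factorial_succ]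
  push_cast
  field_simp

theorem taylorCoeff_const (c : ℂ) (n : ℕ) :
    taylorCoeff (fun _ => c) n = if n = 0 then c else 0 := by
  rcases n with _ | n <;> simp [taylorCoeff, iteratedDeriv_const]

theorem taylorCoeff_id (n : ℕ) : taylorCoeff (fun z => z) n = if n = 1 then 1 else 0 := by
  rcases n with _ | _ | n <;> simp [taylorCoeff, iteratedDeriv_fun_id_zero]

theorem taylorCoeff_add {f g : ℂ → ℂ} (hf : AnalyticAt ℂ f 0) (hg : AnalyticAt ℂ g 0) (n : ℕ) :
    taylorCoeff (fun z => f z + g z) n = taylorCoeff f n + taylorCoeff g n := by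
  simp only [taylorCoeff, iteratedDeriv_fun_add hf.contDiffAt hg.contDiffAt, add_div]

theorem taylorCoeff_mul {f g : ℂ → ℂ} (hf : AnalyticAt ℂ f 0) (hg : AnalyticAt ℂ g 0) (n : ℕ) :
    taylorCoeff (fun z => f z * g z) n =
      ∑ i ∈ Finset.range (n + 1), taylorCoeff f i * taylorCoeff g (n - i) := by
  simp only [taylorCoeff, iteratedDeriv_fun_mul hf.contDiffAt hg.contDiffAt, Finset.sum_div]
  refine Finset.sum_congr rfl fun i hi => ?_
  rw [Nat.cast_choose ℂ (Nat.lt_succ_iff.1 (Finset.mem_range.1 hi))]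
  have h (m : ℕ) : (m.factorial : ℂ) ≠ 0 := by exact_mod_cast m.factorial_ne_zero
  have := h n
  have := h i
  have := h (n - i)
  field_simp

theorem taylorCoeff_id_mul {f : ℂ → ℂ} (hf : AnalyticAt ℂ f 0) (n : ℕ) :
    taylorCoeff (fun z => z * f z) n = if n = 0 then 0 else taylorCoeff f (n - 1) := by
  rw [taylorCoeff_mul (by fun_prop) hf]
  simp only [taylorCoeff_id, ite_mul, one_mul, zero_mul, Finset.sum_ite_eq', Finset.mem_range]
  rcases n with _ | n <;> simp

/-! ### Coefficient formulas for `f` and for a left inverse. -/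

/-- The coefficients of `f`, in terms of those of `φ`, if
`(1 - z + z²) f' = (1 + z φ) / (1 - z φ)`. -/
theorem taylorCoeff_eq_of_deriv {f φ : ℂ → ℂ} (hf : AnalyticAt ℂ f 0) (hφ : AnalyticAt ℂ φ 0)
    (h1 : deriv f 0 = 1)
    (h : ∀ᶠ z in 𝓝 0, (1 - z + z ^ 2) * deriv f z * (1 - z * φ z) = 1 + z * φ z) :
    taylorCoeff f 2 = 1 / 2 + taylorCoeff φ 0 ∧
    taylorCoeff f 3 = 2 / 3 * (taylorCoeff φ 1 + taylorCoeff φ 0 ^ 2 + taylorCoeff φ 0) ∧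
    taylorCoeff f 4 = 1 / 4 * (2 * (taylorCoeff φ 2 + 2 * taylorCoeff φ 0 * taylorCoeff φ 1
      + taylorCoeff φ 0 ^ 3) + 2 * (taylorCoeff φ 1 + taylorCoeff φ 0 ^ 2) - 1) ∧
    taylorCoeff f 5 = 1 / 5 * (2 * (taylorCoeff φ 3 + 2 * taylorCoeff φ 0 * taylorCoeff φ 2
      + taylorCoeff φ 1 ^ 2 + 3 * taylorCoeff φ 0 ^ 2 * taylorCoeff φ 1 + taylorCoeff φ 0 ^ 4)
      + 2 * (taylorCoeff φ 2 + 2 * taylorCoeff φ 0 * taylorCoeff φ 1 + taylorCoeff φ 0 ^ 3)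
      - 2 * taylorCoeff φ 0 - 1) := by
  have hd := hf.deriv
  -- This is `(1 - z + z²) f'`, arranged so that multiplication by `z` acts as an index shift.
  set q : ℂ → ℂ := fun z => deriv f z + z * ((-1 + z) * deriv f z) with hq
  have hqa : AnalyticAt ℂ q 0 := by fun_prop
  have hrec (n : ℕ) : taylorCoeff q (n + 1) =
      taylorCoeff φ n + ∑ i ∈ Finset.range (n + 1), taylorCoeff φ i * taylorCoeff q (n - i) := by
    -- Without denominators the relation is a fixed-point equation, which determines each
    -- coefficient of `q` from earlier ones.
    have : q =ᶠ[𝓝 0] fun z => 1 + z * (φ z + φ z * q z) := by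
      filter_upwards [h] with z hz
      simp only [hq]
      linear_combination hz
    rw [taylorCoeff_congr this, taylorCoeff_add (by fun_prop) (by fun_prop), taylorCoeff_const,
      taylorCoeff_id_mul (by fun_prop), taylorCoeff_add hφ (by fun_prop), taylorCoeff_mul hφ hqa]
    simp
  have hqc (n : ℕ) : taylorCoeff q (n + 2) = taylorCoeff (deriv f) (n + 2)
      - taylorCoeff (deriv f) (n + 1) + taylorCoeff (deriv f) n := by
    have : q = fun z => deriv f z + z * (-1 * deriv f z + z * deriv f z) := by
      funext z
      simp only [hq]
      ring
    rw [this, taylorCoeff_add hd (by fun_prop), taylorCoeff_id_mul (by fun_prop),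
      taylorCoeff_add (by fun_prop) (by fun_prop), taylorCoeff_id_mul hd,
      taylorCoeff_mul (by fun_prop) hd]
    simp [taylorCoeff_const, sub_eq_add_neg, add_assoc]
  have hq0 : taylorCoeff q 0 = 1 := by simp [taylorCoeff_zero, hq, h1]
  have hq1 : taylorCoeff q 1 = taylorCoeff (deriv f) 1 - taylorCoeff (deriv f) 0 := by
    rw [hq, taylorCoeff_add hd (by fun_prop), taylorCoeff_id_mul (by fun_prop)]
    simp [taylorCoeff_zero, sub_eq_add_neg]
  have e0 := hrec 0
  have e1 := hrec 1
  have e2 := hrec 2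
  have e3 := hrec 3
  have g0 := hqc 0
  have g1 := hqc 1
  have g2 := hqc 2
  simp only [Finset.sum_range_succ, Finset.sum_range_zero, taylorCoeff_deriv] at e0 e1 e2 e3 g0 g1 g2 hq1
  norm_num at e0 e1 e2 e3 g0 g1 g2 hq1
  rw [hq0] at e0 e1 e2 e3
  rw [taylorCoeff_one f, h1] at g0 hq1
  rw [e0] at e1 e2 e3 hq1
  rw [e1] at e2 e3 g0
  rw [e2] at e3 g1
  rw [e3] at g2
  have a2 : taylorCoeff f 2 = 1 / 2 + taylorCoeff φ 0 := by linear_combination -1 / 2 * hq1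
  rw [a2] at g0 g1
  have a3 : taylorCoeff f 3 =
      2 / 3 * (taylorCoeff φ 1 + taylorCoeff φ 0 ^ 2 + taylorCoeff φ 0) := by
    linear_combination -1 / 3 * g0
  rw [a3] at g1 g2
  have a4 : taylorCoeff f 4 = 1 / 4 * (2 * (taylorCoeff φ 2 + 2 * taylorCoeff φ 0 * taylorCoeff φ 1
      + taylorCoeff φ 0 ^ 3) + 2 * (taylorCoeff φ 1 + taylorCoeff φ 0 ^ 2) - 1) := by
    linear_combination -1 / 4 * g1
  rw [a4] at g2
  refine ⟨a2, a3, a4, ?_⟩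
  linear_combination -1 / 5 * g2

/-- The coefficients of a left inverse `g` of `f`, for `f z = z + a₂ z² + ⋯`. -/
theorem taylorCoeff_of_leftInverse {f g : ℂ → ℂ} (hf : AnalyticAt ℂ f 0) (hg : AnalyticAt ℂ g 0)
    (h0 : f 0 = 0) (h1 : deriv f 0 = 1) (h : ∀ᶠ z in 𝓝 0, g (f z) = z) :
    taylorCoeff g 2 = -taylorCoeff f 2 ∧
    taylorCoeff g 3 = 2 * taylorCoeff f 2 ^ 2 - taylorCoeff f 3 ∧
    taylorCoeff g 4 = -5 * taylorCoeff f 2 ^ 3 + 5 * taylorCoeff f 2 * taylorCoeff f 3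
      - taylorCoeff f 4 ∧
    taylorCoeff g 5 = 14 * taylorCoeff f 2 ^ 4 - 21 * taylorCoeff f 2 ^ 2 * taylorCoeff f 3
      + 6 * taylorCoeff f 2 * taylorCoeff f 4 + 3 * taylorCoeff f 3 ^ 2 - taylorCoeff f 5 := by
  have hfa : ∀ᶠ z in 𝓝 0, AnalyticAt ℂ f z := hf.eventually_analyticAt
  have hga : ∀ᶠ z in 𝓝 0, AnalyticAt ℂ g (f z) := by
    have := hf.continuousAt.tendsto
    rw [h0] at this
    exact this.eventually hg.eventually_analyticAt
  set F : ℕ → ℂ → ℂ := fun n => iteratedDeriv n f with hF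
  set G : ℕ → ℂ → ℂ := fun n z => iteratedDeriv n g (f z) with hG
  have dF : ∀ᶠ z in 𝓝 0, ∀ n, HasDerivAt (F n) (F (n + 1) z) z := by
    filter_upwards [hfa] with z hz n
    simp only [hF, iteratedDeriv_succ]
    have : AnalyticAt ℂ (iteratedDeriv n f) z := by
      simpa only [iteratedDeriv_eq_iterate] using hz.iterated_deriv n
    exact this.differentiableAt.hasDerivAt
  have dG : ∀ᶠ z in 𝓝 0, ∀ n, HasDerivAt (G n) (G (n + 1) z * F 1 z) z := by
    filter_upwards [hfa, hga] with z hz hz' n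
    simp only [hG, hF, iteratedDeriv_succ]
    have : AnalyticAt ℂ (iteratedDeriv n g) (f z) := by
      simpa only [iteratedDeriv_eq_iterate] using hz'.iterated_deriv n
    exact this.differentiableAt.hasDerivAt.comp z hz.differentiableAt.hasDerivAt
  have key {u u' v v' : ℂ → ℂ} (huv : ∀ᶠ z in 𝓝 0, u z = v z)
      (hu : ∀ᶠ z in 𝓝 0, HasDerivAt u (u' z) z) (hv : ∀ᶠ z in 𝓝 0, HasDerivAt v (v' z) z) :
      ∀ᶠ z in 𝓝 0, u' z = v' z := by
    filter_upwards [huv.eventually_nhds, hu, hv] with z h1 h2 h3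
    exact h2.unique (h3.congr_of_eventuallyEq h1)
  -- Differentiating `g (f z) = z` five times and evaluating at `0` gives a triangular system for
  -- the coefficients of `g`.
  have s0 : ∀ᶠ z in 𝓝 0, G 0 z = z := by simpa [hG] using h
  have s1 : ∀ᶠ z in 𝓝 0, G 1 z * F 1 z = 1 := by
    refine key s0 ?_ (.of_forall fun z => hasDerivAt_id z)
    filter_upwards [dG] with z hz using hz 0
  have s2 : ∀ᶠ z in 𝓝 0, G 2 z * F 1 z ^ 2 + G 1 z * F 2 z = 0 := by
    refine key s1 ?_ (.of_forall fun z => hasDerivAt_const z _)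
    filter_upwards [dG, dF] with z hz hz'
    exact ((hz 1).mul (hz' 1)).congr_deriv (by ring)
  have s3 : ∀ᶠ z in 𝓝 0,
      G 3 z * F 1 z ^ 3 + 3 * G 2 z * F 1 z * F 2 z + G 1 z * F 3 z = 0 := by
    refine key s2 ?_ (.of_forall fun z => hasDerivAt_const z _)
    filter_upwards [dG, dF] with z hz hz'
    exact (((hz 2).mul ((hz' 1).pow 2)).add ((hz 1).mul (hz' 2))).congr_deriv (by
      norm_num; ring)
  have s4 : ∀ᶠ z in 𝓝 0, G 4 z * F 1 z ^ 4 + 6 * G 3 z * F 1 z ^ 2 * F 2 z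
      + G 2 z * (4 * F 1 z * F 3 z + 3 * F 2 z ^ 2) + G 1 z * F 4 z = 0 := by
    refine key s3 ?_ (.of_forall fun z => hasDerivAt_const z _)
    filter_upwards [dG, dF] with z hz hz'
    exact ((((hz 3).mul ((hz' 1).pow 3)).add
      ((((hz 2).const_mul 3).mul (hz' 1)).mul (hz' 2))).add ((hz 1).mul (hz' 3))).congr_deriv (by
        norm_num; ring)
  have s5 : ∀ᶠ z in 𝓝 0, G 5 z * F 1 z ^ 5 + 10 * G 4 z * F 1 z ^ 3 * F 2 z
      + G 3 z * (10 * F 3 z * F 1 z ^ 2 + 15 * F 2 z ^ 2 * F 1 z)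
      + G 2 z * (5 * F 4 z * F 1 z + 10 * F 2 z * F 3 z) + G 1 z * F 5 z = 0 := by
    refine key s4 ?_ (.of_forall fun z => hasDerivAt_const z _)
    filter_upwards [dG, dF] with z hz hz'
    exact (((((hz 4).mul ((hz' 1).pow 4)).add
      ((((hz 3).const_mul 6).mul ((hz' 1).pow 2)).mul (hz' 2))).add
      ((hz 2).mul ((((hz' 1).const_mul 4).mul (hz' 3)).add (((hz' 2).pow 2).const_mul 3)))).add
      ((hz 1).mul (hz' 4))).congr_deriv (by norm_num; ring)
  have tF (n : ℕ) : F n 0 = n.factorial * taylorCoeff f n := by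
    simp only [taylorCoeff, hF]
    field_simp [n.factorial_ne_zero]
  have tG (n : ℕ) : G n 0 = n.factorial * taylorCoeff g n := by
    simp only [taylorCoeff, hG, h0]
    field_simp [n.factorial_ne_zero]
  have t1 := s1.self_of_nhds
  have t2 := s2.self_of_nhds
  have t3 := s3.self_of_nhds
  have t4 := s4.self_of_nhds
  have t5 := s5.self_of_nhds
  have f1 : taylorCoeff f 1 = 1 := by rw [taylorCoeff_one, h1]
  simp only [tF, tG, Nat.factorial, f1] at t1 t2 t3 t4 t5
  norm_num at t1 t2 t3 t4 t5
  rw [t1] at t2 t3 t4 t5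
  have g2 : taylorCoeff g 2 = -taylorCoeff f 2 := by linear_combination 1 / 2 * t2
  rw [g2] at t3 t4 t5
  have g3 : taylorCoeff g 3 = 2 * taylorCoeff f 2 ^ 2 - taylorCoeff f 3 := by
    linear_combination 1 / 6 * t3
  rw [g3] at t4 t5
  have g4 : taylorCoeff g 4 = -5 * taylorCoeff f 2 ^ 3 + 5 * taylorCoeff f 2 * taylorCoeff f 3
      - taylorCoeff f 4 := by
    linear_combination 1 / 24 * t4
  rw [g4] at t5
  refine ⟨g2, g3, g4, ?_⟩
  linear_combination 1 / 120 * t5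

/-! ### Wiener's coefficient inequality. -/

/-- Iterating `dslope` at `0` strips off one coefficient at a time; the identity is algebraic, hence
valid at every `z`. -/
theorem exists_taylor_remainder {φ : ℂ → ℂ} (hφ : AnalyticAt ℂ φ 0) (n : ℕ) :
    ∃ h : ℂ → ℂ, AnalyticAt ℂ h 0 ∧ (∀ m, taylorCoeff h m = taylorCoeff φ (n + m)) ∧
      ∀ z, φ z = ∑ j ∈ Finset.range n, taylorCoeff φ j * z ^ j + z ^ n * h z := by
  induction n with
  | zero => exact ⟨φ, hφ, by simp, by simp⟩
  | succ n ih =>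
    obtain ⟨h, ha, hc, hs⟩ := ih
    have hda : AnalyticAt ℂ (dslope h 0) 0 := by
      obtain ⟨p, hp⟩ := ha
      exact hp.has_fpower_series_dslope_fslope.analyticAt
    have hd (z : ℂ) : h z = h 0 + z * dslope h 0 z := by
      have := sub_smul_dslope h 0 z
      simp only [sub_zero, smul_eq_mul] at this
      rw [this]
      ring
    refine ⟨dslope h 0, hda, fun m => ?_, fun z => ?_⟩
    · have : h = fun z => h 0 + z * dslope h 0 z := funext hd
      have h2 := hc (m + 1)
      rw [this, taylorCoeff_add (by fun_prop) (by fun_prop), taylorCoeff_id_mul hda,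
        taylorCoeff_const] at h2
      simp only [Nat.add_eq_zero_iff, one_ne_zero, and_false, if_false, zero_add,
        Nat.add_sub_cancel] at h2
      rw [h2]
      congr 1
      ring
    · have h0 : taylorCoeff φ n = h 0 := by rw [← taylorCoeff_zero h, hc, add_zero]
      rw [Finset.sum_range_succ, h0, hs z, hd z]
      ring

/-- The difference of the squared norms is `(1 - |s|²)(1 - |a|²)`. -/
theorem norm_sub_le_norm_one_sub {s a : ℂ} (hs : ‖s‖ ≤ 1) (ha : ‖a‖ ≤ 1) :
    ‖s - a‖ ≤ ‖1 - (starRingEnd ℂ) a * s‖ := by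
  have h1 : ‖s‖ ^ 2 ≤ 1 := pow_le_one₀ (norm_nonneg _) hs
  have h2 : ‖a‖ ^ 2 ≤ 1 := pow_le_one₀ (norm_nonneg _) ha
  rw [← sq_le_sq₀ (norm_nonneg _) (norm_nonneg _)]
  have e (z : ℂ) : ‖z‖ ^ 2 = z.re ^ 2 + z.im ^ 2 := by
    rw [← normSq_eq_norm_sq, normSq_apply]
    ring
  rw [e] at h1 h2 ⊢
  rw [e]
  simp
  nlinarith [mul_nonneg (sub_nonneg.2 h1) (sub_nonneg.2 h2)]

/-- The Schwarz-Pick inequality at the origin, for a function `g` agreeing with `g 0` to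
order `n`. -/
theorem norm_le_one_sub_sq_of_eq_add_pow_mul {g H : ℂ → ℂ} {n : ℕ} (hn : n ≠ 0)
    (hg : DifferentiableOn ℂ g (ball 0 1)) (hb : ∀ z ∈ ball (0 : ℂ) 1, ‖g z‖ ≤ 1)
    (hH : ContinuousAt H 0) (h : ∀ z ∈ ball (0 : ℂ) 1, g z = g 0 + z ^ n * H z) :
    ‖H 0‖ ≤ 1 - ‖g 0‖ ^ 2 := by
  have hball : ball (0 : ℂ) 1 ∈ 𝓝 0 := ball_mem_nhds _ one_pos
  have h0 : (0 : ℂ) ∈ ball (0 : ℂ) 1 := mem_ball_self one_pos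
  have hgc : ContinuousAt g 0 := hg.continuousOn.continuousAt hball
  -- Scaling `g` by `r < 1` keeps the Möbius denominator `D` nonzero even when `|g|` reaches `1`; at
  -- the end `r → 1`.
  have key (r : ℝ) (hr0 : 0 < r) (hr1 : r < 1) : r * ‖H 0‖ ≤ 1 - (r * ‖g 0‖) ^ 2 := by
    set a : ℂ := r * g 0 with ha
    have hrn : ‖(r : ℂ)‖ = r := by simp [abs_of_pos hr0]
    have hs1 : ∀ z ∈ ball (0 : ℂ) 1, ‖(r : ℂ) * g z‖ ≤ r := fun z hz => by
      rw [norm_mul, hrn]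
      exact mul_le_of_le_one_right hr0.le (hb z hz)
    have hden : ∀ z ∈ ball (0 : ℂ) 1, 1 - (starRingEnd ℂ) a * (r * g z) ≠ 0 := fun z hz h' => by
      have : ‖(starRingEnd ℂ) a * (r * g z)‖ < 1 := by
        rw [norm_mul, RCLike.norm_conj]
        nlinarith [hs1 z hz, hs1 0 h0, norm_nonneg a, norm_nonneg ((r : ℂ) * g z)]
      rw [← sub_eq_zero.1 h', norm_one] at this
      exact lt_irrefl _ this
    set D : ℂ → ℂ := fun z => 1 - (starRingEnd ℂ) a * (r * g z) with hD
    set M : ℂ → ℂ := fun z => (r * g z - a) / D z with hM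
    have hDc : ContinuousAt D 0 := by fun_prop
    have hMd : DifferentiableOn ℂ M (ball 0 1) := by
      refine DifferentiableOn.div (by fun_prop) (by fun_prop) hden
    have hM0 : M 0 = 0 := by simp [hM, ha]
    have hMe : ∀ z ∈ ball (0 : ℂ) 1, M z = z ^ n * (r * H z / D z) := fun z hz => by
      simp only [hM, ha]
      rw [h z hz]
      ring
    have hMb : Set.MapsTo M (ball 0 1) (closedBall (M 0) 1) := fun z hz => by
      rw [hM0, mem_closedBall_zero_iff, norm_div, div_le_one (norm_pos_iff.2 (hden z hz))]
      exact norm_sub_le_norm_one_sub ((hs1 z hz).trans hr1.le) ((hs1 0 h0).trans hr1.le)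
    -- `M` vanishes to order `n`, that is, it is `o(|z|^(n-1))`; the higher-order Schwarz lemma then
    -- yields `|M z| ≤ |z|^n`.
    have hlo : (fun z => M z - M 0) =o[𝓝 0] fun z => ‖z - 0‖ ^ (n - 1) := by
      have hK : (fun z => r * H z / D z) =O[𝓝 0] fun _ => (1 : ℂ) := by
        have : ContinuousAt (fun z => r * H z / D z) 0 :=
          (continuousAt_const.mul hH).div hDc (hden 0 h0)
        exact this.isBigO_one ℂ
      have h1 : (fun z : ℂ => z ^ n * (r * H z / D z)) =O[𝓝 0] fun z => z ^ n * 1 :=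
        (Asymptotics.isBigO_refl _ _).mul hK
      have h2 : (fun z : ℂ => z ^ n) =o[𝓝 0] fun z => z ^ (n - 1) :=
        Asymptotics.isLittleO_pow_pow (by omega)
      have h3 : (fun z : ℂ => z ^ n * (r * H z / D z)) =o[𝓝 0] fun z => z ^ (n - 1) := by
        simpa using h1.trans_isLittleO (by simpa using h2)
      simp only [hM0, sub_zero]
      refine (h3.congr' ?_ .rfl).trans_isBigO ?_
      · filter_upwards [hball] with z hz using (hMe z hz).symm
      · simpa using (Asymptotics.isBigO_refl (fun z : ℂ => z ^ (n - 1)) (𝓝 0)).norm_right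
    -- Off the origin `z^n` cancels; continuity carries the bound to `0`, where `D 0 = 1 - |a|²`.
    have hbound : ∀ᶠ z in 𝓝[≠] (0 : ℂ), ‖(r : ℂ) * H z‖ ≤ ‖D z‖ := by
      filter_upwards [self_mem_nhdsWithin, nhdsWithin_le_nhds hball] with z hz0 hz
      have h1 := dist_le_mul_div_pow_of_mapsTo_ball_of_isLittleO hMd hMb hlo hz
      rw [hM0, dist_zero_right, dist_zero_right, Nat.sub_add_cancel (by omega), hMe z hz, norm_mul,
        norm_pow, div_one, one_mul] at h1
      have h2 : 0 < ‖z‖ ^ n := pow_pos (norm_pos_iff.2 hz0) n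
      have h3 := le_of_mul_le_mul_left (h1.trans_eq (mul_one _).symm) h2
      rwa [norm_div, div_le_one (norm_pos_iff.2 (hden z hz))] at h3
    have h4 : ‖(r : ℂ) * H 0‖ ≤ ‖D 0‖ :=
      le_of_tendsto_of_tendsto
        ((continuousAt_const.mul hH).norm.tendsto.mono_left nhdsWithin_le_nhds)
        (hDc.norm.tendsto.mono_left nhdsWithin_le_nhds) hbound
    have h5 : D 0 = ((1 - ‖a‖ ^ 2 : ℝ) : ℂ) := by
      simp only [hD]
      rw [← ha, conj_mul']
      push_cast
      rfl
    have h6 : ‖a‖ = r * ‖g 0‖ := by rw [ha, norm_mul, hrn]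
    have h7 : 0 ≤ 1 - ‖a‖ ^ 2 := by nlinarith [hs1 0 h0, norm_nonneg a]
    rwa [h5, norm_real, Real.norm_eq_abs, abs_of_nonneg h7, h6, norm_mul, hrn] at h4
  have hl : Tendsto (fun r : ℝ => r * ‖H 0‖) (𝓝[<] 1) (𝓝 (1 * ‖H 0‖)) :=
    (Continuous.tendsto (by fun_prop) 1).mono_left nhdsWithin_le_nhds
  have hr : Tendsto (fun r : ℝ => 1 - (r * ‖g 0‖) ^ 2) (𝓝[<] 1) (𝓝 (1 - (1 * ‖g 0‖) ^ 2)) :=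
    ((by fun_prop : Continuous fun r : ℝ => 1 - (r * ‖g 0‖) ^ 2).tendsto 1).mono_left
      nhdsWithin_le_nhds
  have := le_of_tendsto_of_tendsto hl hr (by
    filter_upwards [Ioo_mem_nhdsLT (zero_lt_one (α := ℝ))] with r hr using key r hr.1 hr.2)
  simpa using this

/-- F. Wiener's inequality: if `φ` is bounded by `1` on the unit disk, then each of its
coefficients other than `φ 0` is at most `1 - ‖φ 0‖²`. -/
theorem norm_taylorCoeff_le_one_sub_sq {φ : ℂ → ℂ} {n : ℕ} (hn : n ≠ 0)
    (hφ : DifferentiableOn ℂ φ (ball 0 1)) (hb : ∀ z ∈ ball (0 : ℂ) 1, ‖φ z‖ ≤ 1) :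
    ‖taylorCoeff φ n‖ ≤ 1 - ‖taylorCoeff φ 0‖ ^ 2 := by
  obtain ⟨h, ha, hc, hs⟩ := exists_taylor_remainder
    (hφ.analyticAt (ball_mem_nhds (0 : ℂ) one_pos)) n
  obtain ⟨ζ, hζ⟩ : ∃ ζ : ℂ, IsPrimitiveRoot ζ n := ⟨_, Complex.isPrimitiveRoot_exp n hn⟩
  have hζ1 : ‖ζ‖ = 1 := hζ.norm'_eq_one hn
  have hn' : (n : ℂ) ≠ 0 := by exact_mod_cast hn
  have hmem (k : ℕ) {z : ℂ} (hz : z ∈ ball (0 : ℂ) 1) : ζ ^ k * z ∈ ball (0 : ℂ) 1 := by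
    simpa [hζ1] using hz
  -- Averaging over rotations by `n`-th roots of unity kills the coefficients of index `1, …, n -
  -- 1`, keeps those of index `0` and `n`, and preserves the bound `1`.
  set g : ℂ → ℂ := fun z => (n : ℂ)⁻¹ * ∑ k ∈ Finset.range n, φ (ζ ^ k * z) with hg
  set H : ℂ → ℂ := fun z => (n : ℂ)⁻¹ * ∑ k ∈ Finset.range n, h (ζ ^ k * z) with hH
  have hg0 : g 0 = taylorCoeff φ 0 := by
    simp [hg, taylorCoeff_zero, hn']
  have hH0 : H 0 = taylorCoeff φ n := by
    have := hc 0
    rw [taylorCoeff_zero, add_zero] at this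
    simp [hH, this, hn']
  rw [← hH0, ← hg0]
  refine norm_le_one_sub_sq_of_eq_add_pow_mul hn ?_ (fun z hz => ?_) ?_ (fun z _ => ?_)
  · refine (DifferentiableOn.fun_sum fun k _ => ?_).const_mul _
    exact hφ.comp (by fun_prop) fun z hz => hmem k hz
  · rw [hg, norm_mul, norm_inv, norm_natCast, inv_mul_le_iff₀ (by positivity), mul_one]
    refine (norm_sum_le _ _).trans ?_
    refine (Finset.sum_le_sum fun k _ => hb _ (hmem k hz)).trans ?_
    simp
  · refine continuousAt_const.mul (tendsto_finsetSum _ fun k _ => ?_)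
    have : ContinuousAt h (ζ ^ k * 0) := by simpa using ha.continuousAt
    exact ContinuousAt.comp (f := fun z => ζ ^ k * z) this (by fun_prop)
  · have hsum : ∑ k ∈ Finset.range n, ∑ j ∈ Finset.range n, taylorCoeff φ j * (ζ ^ k * z) ^ j
        = n * taylorCoeff φ 0 := by
      rw [Finset.sum_comm, Finset.sum_eq_single_of_mem 0 (Finset.mem_range.2 (by omega))]
      · simp
      · intro j hj hj0
        have hne : ζ ^ j ≠ 1 := hζ.pow_ne_one_of_pos_of_lt hj0 (Finset.mem_range.1 hj)
        have hgeom : ∑ k ∈ Finset.range n, (ζ ^ j) ^ k = 0 := by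
          rw [geom_sum_eq hne, ← pow_mul, mul_comm, pow_mul, hζ.pow_eq_one, one_pow, sub_self,
            zero_div]
        calc ∑ k ∈ Finset.range n, taylorCoeff φ j * (ζ ^ k * z) ^ j
            = taylorCoeff φ j * z ^ j * ∑ k ∈ Finset.range n, (ζ ^ j) ^ k := by
              rw [Finset.mul_sum]
              exact Finset.sum_congr rfl fun k _ => by ring
          _ = 0 := by rw [hgeom, mul_zero]
    have hpow (k : ℕ) : (ζ ^ k * z) ^ n = z ^ n := by
      rw [mul_pow, ← pow_mul, mul_comm k, pow_mul, hζ.pow_eq_one, one_pow, one_mul]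
    rw [hg0]
    simp only [hg, hH]
    rw [Finset.sum_congr rfl fun k _ => hs (ζ ^ k * z), Finset.sum_add_distrib, hsum]
    simp only [hpow, ← Finset.mul_sum]
    rw [mul_add, inv_mul_cancel_left₀ hn']
    ring

/-! ### Univalence. -/

/-- The Noshiro-Warschawski criterion. -/
theorem injOn_of_convex_of_re_deriv_pos {S : Set ℂ} (hS : Convex ℝ S) {F F' : ℂ → ℂ} (c : ℂ)
    (hF : ∀ s ∈ S, HasDerivAt F (F' s) s) (hpos : ∀ s ∈ S, 0 < (c * F' s).re) :
    Set.InjOn F S := by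
  intro s₁ h₁ s₂ h₂ heq
  by_contra hne
  set d := s₂ - s₁ with hd
  have hd0 : 0 < normSq d := normSq_pos.2 (sub_ne_zero.2 (Ne.symm hne))
  have hmem (t : ℝ) (ht : t ∈ Set.Icc (0 : ℝ) 1) : s₁ + t * d ∈ S := by
    have := hS.add_smul_sub_mem h₁ h₂ ht
    simpa [hd] using this
  -- If `F s₁ = F s₂`, this real function has equal end values, yet its derivative is positive: the
  -- mean value theorem gives a contradiction.
  have hder (t : ℝ) (ht : t ∈ Set.Icc (0 : ℝ) 1) :
      HasDerivAt (fun t : ℝ => (c * (starRingEnd ℂ) d * F (s₁ + t * d)).re)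
        (normSq d * (c * F' (s₁ + t * d)).re) t := by
    have hl : HasDerivAt (fun w : ℂ => s₁ + w * d) d (t : ℂ) := by
      simpa using ((hasDerivAt_id (t : ℂ)).mul_const d).const_add s₁
    have h := (((hF _ (hmem t ht)).comp (t : ℂ) hl).const_mul
      (c * (starRingEnd ℂ) d)).real_of_complex
    refine h.congr_deriv ?_
    rw [show c * (starRingEnd ℂ) d * (F' (s₁ + t * d) * d)
      = (normSq d : ℂ) * (c * F' (s₁ + t * d)) by rw [← mul_conj]; ring, re_ofReal_mul]
  obtain ⟨t, ht, hslope⟩ := exists_hasDerivAt_eq_slope _ _ one_pos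
    (fun t ht => (hder t ht).continuousAt.continuousWithinAt)
    (fun t ht => hder t (Set.Ioo_subset_Icc_self ht))
  have h := mul_pos hd0 (hpos _ (hmem t (Set.Ioo_subset_Icc_self ht)))
  rw [hslope] at h
  simp [hd, heq] at h

/-- Functions in `ℱ₃` are univalent. -/
theorem injOn_of_mem_classF3 {f : ℂ → ℂ} (hf : f ∈ classF3) : Set.InjOn f (ball 0 1) := by
  obtain ⟨⟨hfd, -, -⟩, hpos⟩ := hf
  set r : ℂ := ((√3 : ℝ) : ℂ) with hr
  have hr2 : r ^ 2 = 3 := by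
    rw [hr, ← ofReal_pow, Real.sq_sqrt (by norm_num)]
    norm_num
  have h3 : √3 ^ 2 = 3 := Real.sq_sqrt (by norm_num)
  have h3' : 0 < √3 := by positivity
  have hI := I_sq
  have hr0 : r ≠ 0 := by
    rw [hr]
    exact_mod_cast h3'.ne'
  have hsq (z : ℂ) : ‖z‖ ^ 2 = z.re ^ 2 + z.im ^ 2 := by
    rw [← normSq_eq_norm_sq, normSq_apply]
    ring
  -- Here `a = exp(-iπ/3)` and `b = I * a`. The Möbius map `E ↦ (bE - 1) / (IE - a)` takes the right
  -- half-plane onto the disk and sends `∞` and `0` to `a` and `1 / a`, the roots of `1 - z + z²`.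
  set b : ℂ := (r + I) / 2 with hb
  set a : ℂ := (1 - r * I) / 2 with ha
  set S : Set ℂ := {s | s.im < Real.pi / 2} ∩ {s | -(Real.pi / 2) < s.im} with hS
  have hSc : Convex ℝ S := (convex_halfSpace_im_lt _).inter (convex_halfSpace_im_gt _)
  set Z : ℂ → ℂ := fun s => (b * exp s - 1) / (I * exp s - a) with hZ
  have hlt {E : ℂ} (hE : 0 < E.re) : ‖b * E - 1‖ < ‖I * E - a‖ := by
    rw [← sq_lt_sq₀ (norm_nonneg _) (norm_nonneg _), hsq, hsq]
    simp [ha, hb, hr]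
    nlinarith [mul_pos h3' hE, congrArg (· * (E.re ^ 2 + E.im ^ 2)) h3]
  have hre {s : ℂ} (hs : s ∈ S) : 0 < (exp s).re := by
    rw [exp_re]
    exact mul_pos (Real.exp_pos _) (Real.cos_pos_of_mem_Ioo ⟨hs.2, hs.1⟩)
  have hden {s : ℂ} (hs : s ∈ S) : I * exp s - a ≠ 0 :=
    norm_pos_iff.1 ((norm_nonneg _).trans_lt (hlt (hre hs)))
  have hZmem {s : ℂ} (hs : s ∈ S) : Z s ∈ ball (0 : ℂ) 1 := by
    rw [mem_ball_zero_iff, hZ, norm_div, div_lt_one (norm_pos_iff.2 (hden hs))]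
    exact hlt (hre hs)
  -- This equation makes `I * r * (f ∘ Z)'` equal to `(1 - Z + Z²) f'(Z)`, whose real part is
  -- positive.
  have hZd {s : ℂ} (hs : s ∈ S) : HasDerivAt Z ((1 - Z s + Z s ^ 2) / (I * r)) s := by
    have h1 := (((hasDerivAt_exp s).const_mul b).sub_const 1).div
      (((hasDerivAt_exp s).const_mul I).sub_const a) (hden hs)
    refine h1.congr_deriv ?_
    have hZs : Z s * (I * exp s - a) = b * exp s - 1 := div_mul_cancel₀ _ (hden hs)
    have hab : a * b = (r - I) / 2 := by
      rw [ha, hb]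
      linear_combination -I / 4 * hr2 - r / 4 * hI
    have e2 : I ^ 2 - I * b + b ^ 2 = 0 := by
      rw [hb]
      linear_combination 1 / 4 * hr2 + 3 / 4 * hI
    have e1 : (I - a * b) * (I * r) = -2 * I * a + a * b + I - 2 * b := by
      rw [hab, ha, hb]
      linear_combination r / 2 * hI - I / 2 * hr2
    have e0 : a ^ 2 - a + 1 = 0 := by
      rw [ha]
      linear_combination r ^ 2 / 4 * hI - 1 / 4 * hr2
    rw [eq_div_iff (mul_ne_zero I_ne_zero hr0), div_mul_eq_mul_div,
      div_eq_iff (pow_ne_zero 2 (hden hs))]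
    linear_combination exp s * e1 - exp s ^ 2 * e2 - e0
      + ((I * exp s - a) - Z s * (I * exp s - a) - (b * exp s - 1)) * hZs
  have hsurj {z : ℂ} (hz : z ∈ ball (0 : ℂ) 1) : ∃ s ∈ S, Z s = z := by
    rw [mem_ball_zero_iff] at hz
    have hz2 : z.re ^ 2 + z.im ^ 2 < 1 := by
      rw [← hsq]
      nlinarith [norm_nonneg z]
    have hbz : b - I * z ≠ 0 := fun h => by
      have hb1 : ‖b‖ ^ 2 = 1 := by
        rw [hsq]
        simp [hb, hr]
        nlinarith
      rw [sub_eq_zero.1 h, norm_mul, norm_I, one_mul, hsq] at hb1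
      linarith
    -- The inverse Möbius map; its logarithm is the preimage in the strip.
    set E : ℂ := (1 - a * z) / (b - I * z) with hE
    have hEre : 0 < E.re := by
      rw [hE, div_re, ← add_div]
      refine div_pos ?_ (normSq_pos.2 hbz)
      simp [ha, hb, hr]
      nlinarith [mul_pos h3' (sub_pos.2 hz2), congrArg (· * z.im) h3]
    have hE0 : E ≠ 0 := fun h => by simp [h] at hEre
    have harg := abs_lt.1 (abs_arg_lt_pi_div_two_iff.2 (Or.inl hEre))
    have hmem : log E ∈ S := by
      simp only [hS, Set.mem_inter_iff, Set.mem_ofPred_eq, log_im]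
      exact ⟨harg.2, harg.1⟩
    refine ⟨log E, hmem, ?_⟩
    have hd := hden hmem
    simp only [hZ]
    rw [exp_log hE0] at hd ⊢
    rw [div_eq_iff hd]
    have : E * (b - I * z) = 1 - a * z := div_mul_cancel₀ _ hbz
    linear_combination this
  have hinj : Set.InjOn (f ∘ Z) S := by
    refine injOn_of_convex_of_re_deriv_pos hSc (I * r) (fun s hs => ?_) (fun s hs => ?_)
      (F' := fun s => deriv f (Z s) * ((1 - Z s + Z s ^ 2) / (I * r)))
    · exact (hfd.differentiableAt (isOpen_ball.mem_nhds (hZmem hs))).hasDerivAt.comp s (hZd hs)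
    · convert hpos (Z s) (hZmem hs) using 2
      field_simp
  intro z₁ h₁ z₂ h₂ heq
  obtain ⟨s₁, hs₁, rfl⟩ := hsurj h₁
  obtain ⟨s₂, hs₂, rfl⟩ := hsurj h₂
  rw [hinj hs₁ hs₂ heq]

/-! ### Inverse coefficients and their bounds. -/

/-- Near `0` the analytic local inverse takes values in the disk, so injectivity forces the chosen
preimage to agree with it. -/
theorem analyticAt_diskInverse {f : ℂ → ℂ} (hf : AnalyticAt ℂ f 0) (h0 : f 0 = 0)
    (h1 : deriv f 0 ≠ 0) (hinj : Set.InjOn f (ball 0 1)) : AnalyticAt ℂ (diskInverse f) 0 := by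
  have hL := hf.analyticAt_localInverse h1
  have hr := hf.hasStrictDerivAt.eventually_right_inverse h1
  set L := hf.hasStrictDerivAt.localInverse _ _ _ h1 with hLdef
  have hL0 : L (f 0) = 0 := HasStrictFDerivAt.localInverse_apply_image ..
  rw [h0] at hL hL0 hr
  refine hL.congr ?_
  have hb : ∀ᶠ w in 𝓝 0, L w ∈ ball (0 : ℂ) 1 :=
    hL.continuousAt.eventually_mem (by rw [hL0]; exact ball_mem_nhds _ one_pos)
  filter_upwards [hr, hb] with w hw hwb
  have hex : ∃ z ∈ ball (0 : ℂ) 1, f z = w := ⟨_, hwb, hw⟩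
  exact hinj hwb (Function.invFunOn_mem hex) (hw.trans (Function.invFunOn_eq hex).symm)

theorem taylorCoeff_diskInverse {f φ : ℂ → ℂ} (hf : f ∈ classF3) (hφ : AnalyticAt ℂ φ 0)
    (h : ∀ᶠ z in 𝓝 0, (1 - z + z ^ 2) * deriv f z * (1 - z * φ z) = 1 + z * φ z) :
    inverseCoeff f 2 = -(1 / 2 + taylorCoeff φ 0) ∧
    inverseCoeff f 3 = 1 / 2 + 4 / 3 * taylorCoeff φ 0 + 4 / 3 * taylorCoeff φ 0 ^ 2
      - 2 / 3 * taylorCoeff φ 1 ∧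
    inverseCoeff f 4 = -(3 / 8 + 25 / 12 * taylorCoeff φ 0 + 3 * taylorCoeff φ 0 ^ 2
      + 13 / 6 * taylorCoeff φ 0 ^ 3) + (7 / 6 + 7 / 3 * taylorCoeff φ 0) * taylorCoeff φ 1
      - 1 / 2 * taylorCoeff φ 2 ∧
    inverseCoeff f 5 = 13 / 40 + 12 / 5 * taylorCoeff φ 0 + 19 / 3 * taylorCoeff φ 0 ^ 2
      + 203 / 30 * taylorCoeff φ 0 ^ 3 + 59 / 15 * taylorCoeff φ 0 ^ 4
      - (2 + 92 / 15 * taylorCoeff φ 0 + 98 / 15 * taylorCoeff φ 0 ^ 2) * taylorCoeff φ 1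
      + (11 / 10 + 11 / 5 * taylorCoeff φ 0) * taylorCoeff φ 2
      + 14 / 15 * taylorCoeff φ 1 ^ 2 - 2 / 5 * taylorCoeff φ 3 := by
  have hinj := injOn_of_mem_classF3 hf
  obtain ⟨⟨hfd, h0, h1⟩, -⟩ := hf
  have hball : ball (0 : ℂ) 1 ∈ 𝓝 0 := ball_mem_nhds _ one_pos
  have hfa := hfd.analyticAt hball
  have hleft : ∀ᶠ z in 𝓝 0, diskInverse f (f z) = z := by
    filter_upwards [hball] with z hz using hinj.leftInvOn_invFunOn hz
  obtain ⟨a2, a3, a4, a5⟩ := taylorCoeff_eq_of_deriv hfa hφ h1 h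
  obtain ⟨d2, d3, d4, d5⟩ := taylorCoeff_of_leftInverse hfa
    (analyticAt_diskInverse hfa h0 (by simp [h1]) hinj) h0 h1 hleft
  simp only [inverseCoeff]
  rw [d2, d3, d4, d5, a2, a3, a4, a5]
  refine ⟨rfl, ?_, ?_, ?_⟩ <;> ring

/-- The Cayley transform `ω = (q - 1) / (q + 1)` maps the disk into the closed disk and fixes `0`;
Schwarz's lemma bounds `φ = ω / z`, realised as `dslope ω 0`. -/
theorem exists_schwarz_function {f : ℂ → ℂ} (hf : f ∈ classF3) :
    ∃ φ : ℂ → ℂ, DifferentiableOn ℂ φ (ball 0 1) ∧ (∀ z ∈ ball (0 : ℂ) 1, ‖φ z‖ ≤ 1) ∧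
      ∀ z ∈ ball (0 : ℂ) 1, (1 - z + z ^ 2) * deriv f z * (1 - z * φ z) = 1 + z * φ z := by
  obtain ⟨⟨hfd, -, h1⟩, hpos⟩ := hf
  set q : ℂ → ℂ := fun z => (1 - z + z ^ 2) * deriv f z with hq
  have hqd : DifferentiableOn ℂ q (ball 0 1) := by
    have := hfd.deriv isOpen_ball
    fun_prop
  have hq1 : ∀ z ∈ ball (0 : ℂ) 1, q z + 1 ≠ 0 := fun z hz h => by
    have h2 := hpos z hz
    have h3 : (q z + 1).re = 0 := by rw [h, zero_re]
    rw [add_re, one_re] at h3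
    change 0 < (q z).re at h2
    linarith
  set ω : ℂ → ℂ := fun z => (q z - 1) / (q z + 1) with hω
  have hωd : DifferentiableOn ℂ ω (ball 0 1) :=
    DifferentiableOn.div (by fun_prop) (by fun_prop) hq1
  have hω0 : ω 0 = 0 := by simp [hω, hq, h1]
  have hωb : Set.MapsTo ω (ball 0 1) (closedBall (ω 0) 1) := fun z hz => by
    rw [hω0, mem_closedBall_zero_iff, norm_div, div_le_one (norm_pos_iff.2 (hq1 z hz)),
      ← sq_le_sq₀ (norm_nonneg _) (norm_nonneg _), ← normSq_eq_norm_sq, ← normSq_eq_norm_sq,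
      normSq_apply, normSq_apply]
    have h2 : 0 < (q z).re := hpos z hz
    simp only [sub_re, add_re, sub_im, add_im, one_re, one_im]
    linarith
  refine ⟨dslope ω 0, ?_, fun z hz => ?_, fun z hz => ?_⟩
  · exact (differentiableOn_dslope (ball_mem_nhds _ one_pos)).2 hωd
  · simpa using norm_dslope_le_div_of_mapsTo_ball hωd hωb hz
  · have h2 : z * dslope ω 0 z = ω z := by
      simpa [hω0] using sub_smul_dslope ω 0 z
    have h3 := hq1 z hz
    rw [h2]
    change q z * (1 - ω z) = 1 + ω z
    simp only [hω]
    field_simp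
    ring

/-- The coefficient bounds hold in `ℱ₃` without any assumption on `a₂`. -/
theorem norm_inverseCoeff_le {f : ℂ → ℂ} (hf : f ∈ classF3) :
    ‖inverseCoeff f 2‖ ≤ 3 / 2 ∧ ‖inverseCoeff f 3‖ ≤ 19 / 6 ∧
    ‖inverseCoeff f 4‖ ≤ 61 / 8 ∧ ‖inverseCoeff f 5‖ ≤ 2371 / 120 := by
  obtain ⟨φ, hφd, hφb, hφ⟩ := exists_schwarz_function hf
  have hball : ball (0 : ℂ) 1 ∈ 𝓝 0 := ball_mem_nhds _ one_pos
  obtain ⟨d2, d3, d4, d5⟩ := taylorCoeff_diskInverse hf (hφd.analyticAt hball)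
    (by filter_upwards [hball] with z hz using hφ z hz)
  rw [d2, d3, d4, d5]
  have ht : ‖taylorCoeff φ 0‖ ≤ 1 := by
    rw [taylorCoeff_zero]
    exact hφb 0 (mem_ball_self one_pos)
  have hu := norm_taylorCoeff_le_one_sub_sq one_ne_zero hφd hφb
  have hv := norm_taylorCoeff_le_one_sub_sq two_ne_zero hφd hφb
  have hw := norm_taylorCoeff_le_one_sub_sq three_ne_zero hφd hφb
  generalize taylorCoeff φ 0 = t at *
  generalize taylorCoeff φ 1 = u at *
  generalize taylorCoeff φ 2 = v at *
  generalize taylorCoeff φ 3 = w at *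
  set r := ‖t‖ with hr
  have hr0 : 0 ≤ r := norm_nonneg t
  have hy0 : 0 ≤ 1 - r ^ 2 := (norm_nonneg _).trans hu
  have hT (c : ℝ) (hc : 0 ≤ c) (n : ℕ) : ‖(c : ℂ) * t ^ n‖ ≤ c * r ^ n := by
    rw [norm_mul, norm_pow, norm_real, Real.norm_of_nonneg hc]
  have hC (c : ℝ) (hc : 0 ≤ c) : ‖(c : ℂ)‖ ≤ c := by
    rw [norm_real, Real.norm_of_nonneg hc]
  have hM {A B : ℂ} {α β : ℝ} (hA : ‖A‖ ≤ α) (hB : ‖B‖ ≤ β) : ‖A * B‖ ≤ α * β := by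
    rw [norm_mul]
    exact mul_le_mul hA hB (norm_nonneg _) ((norm_nonneg _).trans hA)
  -- Tangent-line bounds at `r = 1`: in the final polynomials `r³` (for `δ₄`, `δ₅`) and `r⁴` (for
  -- `δ₅`) have negative coefficients, so they must be bounded below.
  have h3 : 1 - r ^ 3 ≤ 3 * (1 - r) := by nlinarith [mul_nonneg hr0 hr0]
  have h4 : 1 - r ^ 4 ≤ 4 * (1 - r) := by nlinarith [mul_nonneg hr0 hr0, pow_nonneg hr0 3]
  refine ⟨?_, ?_, ?_, ?_⟩
  · have h := norm_add_le_of_le (hC (1 / 2) (by norm_num)) (hT 1 (by norm_num) 1)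
    rw [norm_neg]
    refine (congrArg norm ?_).trans_le (h.trans ?_)
    · push_cast
      ring
    · linarith
  · have h := norm_sub_le_of_le (norm_add_le_of_le (norm_add_le_of_le
      (hC (1 / 2) (by norm_num)) (hT (4 / 3) (by norm_num) 1)) (hT (4 / 3) (by norm_num) 2))
      (hM (hC (2 / 3) (by norm_num)) hu)
    refine (congrArg norm ?_).trans_le (h.trans ?_)
    · push_cast
      ring
    · nlinarith
  · have h := norm_add_le_of_le (norm_sub_le_of_le (norm_add_le_of_le (norm_add_le_of_le
      (norm_add_le_of_le (hC (3 / 8) (by norm_num)) (hT (25 / 12) (by norm_num) 1))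
      (hT 3 (by norm_num) 2)) (hT (13 / 6) (by norm_num) 3))
      (hM (norm_add_le_of_le (hC (7 / 6) (by norm_num)) (hT (7 / 3) (by norm_num) 1)) hu))
      (hM (hC (1 / 2) (by norm_num)) hv)
    rw [← norm_neg]
    refine (congrArg norm ?_).trans_le (h.trans ?_)
    · push_cast
      ring
    · nlinarith
  · have h := norm_sub_le_of_le (norm_add_le_of_le (norm_add_le_of_le (norm_sub_le_of_le
      (norm_add_le_of_le (norm_add_le_of_le (norm_add_le_of_le (norm_add_le_of_le
      (hC (13 / 40) (by norm_num)) (hT (12 / 5) (by norm_num) 1)) (hT (19 / 3) (by norm_num) 2))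
      (hT (203 / 30) (by norm_num) 3)) (hT (59 / 15) (by norm_num) 4))
      (hM (norm_add_le_of_le (norm_add_le_of_le (hC 2 (by norm_num))
        (hT (92 / 15) (by norm_num) 1)) (hT (98 / 15) (by norm_num) 2)) hu))
      (hM (norm_add_le_of_le (hC (11 / 10) (by norm_num)) (hT (11 / 5) (by norm_num) 1)) hv))
      (hM (hC (14 / 15) (by norm_num)) (hM hu hu))) (hM (hC (2 / 5) (by norm_num)) hw)
    refine (congrArg norm ?_).trans_le (h.trans ?_)
    · push_cast
      ring
    · nlinarith [pow_nonneg hr0 3]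

/-! ### The extremal function. -/

theorem one_sub_add_sq_ne_zero {z : ℂ} (hz : z ∈ ball (0 : ℂ) 1) : 1 - z + z ^ 2 ≠ 0 := fun h => by
  have h3 : z ^ 3 = -1 := by linear_combination (1 + z) * h
  have h4 : ‖z‖ ^ 3 = 1 := by rw [← norm_pow, h3, norm_neg, norm_one]
  rw [mem_ball_zero_iff] at hz
  exact (pow_lt_one₀ (norm_nonneg z) hz three_ne_zero).ne h4

theorem exists_extremal : ∃ f ∈ classF3,
    (∀ z ∈ ball (0 : ℂ) 1, deriv f z = (1 - z + z ^ 2)⁻¹ * ((1 + z) / (1 - z))) := by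
  have h1z : ∀ z ∈ ball (0 : ℂ) 1, 1 - z ≠ 0 := fun z hz h => by
    rw [← sub_eq_zero.1 h] at hz
    simp at hz
  have hG : DifferentiableOn ℂ (fun z : ℂ => (1 - z + z ^ 2)⁻¹ * ((1 + z) / (1 - z))) (ball 0 1) :=
    DifferentiableOn.mul (DifferentiableOn.inv (by fun_prop) fun z hz => one_sub_add_sq_ne_zero hz)
      (DifferentiableOn.div (by fun_prop) (by fun_prop) h1z)
  obtain ⟨f, hf0, hf⟩ := hG.isExactOn_ball.with_val_at 0 0
  refine ⟨f, ⟨⟨fun z hz => (hf z hz).differentiableAt.differentiableWithinAt, hf0, ?_⟩,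
    fun z hz => ?_⟩, fun z hz => (hf z hz).deriv⟩
  · rw [(hf 0 (mem_ball_self one_pos)).deriv]
    simp
  · rw [(hf z hz).deriv, mul_inv_cancel_left₀ (one_sub_add_sq_ne_zero hz), div_eq_mul_inv,
      inv_def, ← mul_assoc, re_mul_ofReal]
    refine mul_pos ?_ (inv_pos.2 (normSq_pos.2 (h1z z hz)))
    rw [mem_ball_zero_iff] at hz
    have h2 : z.re * z.re + z.im * z.im < 1 := by
      rw [← normSq_apply, normSq_eq_norm_sq]
      exact pow_lt_one₀ (norm_nonneg z) hz two_ne_zero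
    simp
    linarith

end InverseCoeffs

theorem mainTheorem4 :
    (∀ f ∈ InverseCoeffs.classF3,
      Set.InjOn f (Metric.ball 0 1) ∧
      AnalyticAt ℂ (InverseCoeffs.diskInverse f) 0 ∧
      ‖InverseCoeffs.inverseCoeff f 2‖ ≤ 3 / 2 ∧
      ‖InverseCoeffs.inverseCoeff f 3‖ ≤ 19 / 6 ∧
      ((InverseCoeffs.taylorCoeff f 2).im = 0 →
        ‖InverseCoeffs.inverseCoeff f 4‖ ≤ 61 / 8 ∧
        ‖InverseCoeffs.inverseCoeff f 5‖ ≤ 2371 / 120)) ∧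
    (∃ f ∈ InverseCoeffs.classF3,
      (∀ z ∈ Metric.ball (0 : ℂ) 1,
        z * deriv f z = z * (1 - z + z ^ 2)⁻¹ * ((1 + z) / (1 - z))) ∧
      (InverseCoeffs.taylorCoeff f 2).im = 0 ∧
      ‖InverseCoeffs.inverseCoeff f 2‖ = 3 / 2 ∧
      ‖InverseCoeffs.inverseCoeff f 3‖ = 19 / 6 ∧
      ‖InverseCoeffs.inverseCoeff f 4‖ = 61 / 8 ∧
      ‖InverseCoeffs.inverseCoeff f 5‖ = 2371 / 120) := by
  have hball : Metric.ball (0 : ℂ) 1 ∈ nhds 0 := Metric.ball_mem_nhds _ one_pos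
  constructor
  · intro f hf
    have hinj := InverseCoeffs.injOn_of_mem_classF3 hf
    obtain ⟨h2, h3, h4, h5⟩ := InverseCoeffs.norm_inverseCoeff_le hf
    exact ⟨hinj, InverseCoeffs.analyticAt_diskInverse (hf.1.1.analyticAt hball) hf.1.2.1
      (by simp [hf.1.2.2]) hinj, h2, h3, fun _ => ⟨h4, h5⟩⟩
  · obtain ⟨f, hf, hd⟩ := InverseCoeffs.exists_extremal
    -- The extremal case is `φ = 1`: then `t = 1`, the later coefficients vanish, and the surviving
    -- terms of each `δₙ` share one sign.
    have hrel : ∀ᶠ z in nhds (0 : ℂ), (1 - z + z ^ 2) * deriv f z * (1 - z * 1) = 1 + z * 1 := by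
      filter_upwards [hball] with z hz
      have h1 := InverseCoeffs.one_sub_add_sq_ne_zero hz
      have h2 : 1 - z ≠ 0 := fun h => by
        rw [← sub_eq_zero.1 h] at hz
        simp at hz
      rw [hd z hz]
      field_simp
    obtain ⟨a2, -⟩ := InverseCoeffs.taylorCoeff_eq_of_deriv (hf.1.1.analyticAt hball)
      analyticAt_const hf.1.2.2 hrel
    obtain ⟨d2, d3, d4, d5⟩ := InverseCoeffs.taylorCoeff_diskInverse hf analyticAt_const hrel
    simp only [InverseCoeffs.taylorCoeff_const] at a2 d2 d3 d4 d5
    refine ⟨f, hf, fun z hz => by rw [hd z hz, mul_assoc], ?_, ?_, ?_, ?_, ?_⟩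
    · rw [a2]
      norm_num
    all_goals simp only [d2, d3, d4, d5]; norm_num
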